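/- Let $\mathcal{B}(q)$ be the second order mock theta function and let $b(n)\in\mathbb{Z}$ be its coefficients: $$\mathcal{B}(q)=\sum_{n\ge 0}\frac{q^n(-q;q^2)_n}{(q;q^2)_{n+1}}=\sum_{n\ge 0}b(n)q^n,\qquad (a;q)_n:=\prod_{j=0}^{n-1}(1-aq^j).$$ Let $p$ be an odd prime. If $1\le \ell\le p-1$ is an integer whose Legendre symbol satisfies $\left(\frac{8\ell+1}{p}\right)=-1$, then for all integers $n\ge 0$, $$b\bigl(4(pn+\ell)\bigr)\equiv 0\pmod 8.$$ Moreover, for all integers $n,k\ge 0$, $$b(4n)\equiv b\left(4p^{2k+2}n+\frac{p^{2k+2}-1}{2}\right)\pmod 8.$$ -/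

import Mathlib

namespace SecondOrderMock

open scoped PowerSeries.WithPiTopology

/-- The finite `q`-Pochhammer symbol `(a; q)_n = ∏_{j=0}^{n-1} (1 - a q^j)`. -/
def qPoch {R : Type*} [CommRing R] (a q : R) (n : ℕ) : R :=
  ∏ j ∈ Finset.range n, (1 - a * q ^ j)

/-- The `n`-th summand `q^n (-q; q^2)_n / (q; q^2)_{n+1}` of the series for `B(q)`, as a formal
power series in `q = X` over `ℤ`. The denominator has constant term `1`
(see `constantCoeff_denominator`), so `invOfUnit _ 1` is its inverse (see `mockTerm_mul`). -/
noncomputable def mockTerm (n : ℕ) : PowerSeries ℤ :=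
  PowerSeries.X ^ n * qPoch (-PowerSeries.X) (PowerSeries.X ^ 2) n *
    PowerSeries.invOfUnit (qPoch PowerSeries.X (PowerSeries.X ^ 2) (n + 1)) 1

/-- The second order mock theta function
`B(q) = ∑_{n ≥ 0} q^n (-q; q^2)_n / (q; q^2)_{n+1}` as a formal power series; the sum converges
coefficientwise (see `hasSum_mockB`). -/
noncomputable def mockB : PowerSeries ℤ := ∑' n : ℕ, mockTerm n

/-- The coefficients `b(n)` in `B(q) = ∑_{n ≥ 0} b(n) q^n`. -/
noncomputable def b (n : ℕ) : ℤ := PowerSeries.coeff n mockB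

theorem constantCoeff_denominator (n : ℕ) :
    PowerSeries.constantCoeff (qPoch (PowerSeries.X : PowerSeries ℤ) (PowerSeries.X ^ 2) n) = 1 := by
  simp [qPoch, map_prod]

/-- The summand really is the stated quotient. -/
theorem mockTerm_mul (n : ℕ) :
    mockTerm n * qPoch PowerSeries.X (PowerSeries.X ^ 2) (n + 1) =
      PowerSeries.X ^ n * qPoch (-PowerSeries.X) (PowerSeries.X ^ 2) n := by
  rw [mockTerm, mul_assoc, PowerSeries.invOfUnit_mul _ _ (by simp [constantCoeff_denominator]),
    mul_one]

theorem coeff_mockTerm_of_lt {m n : ℕ} (h : m < n) : PowerSeries.coeff m (mockTerm n) = 0 := by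
  rw [mockTerm, mul_assoc, PowerSeries.coeff_X_pow_mul', if_neg (by omega)]

/-- The series defining `B(q)` converges, so its value is not a default one. -/
theorem hasSum_mockB : HasSum mockTerm mockB := by
  refine Summable.hasSum ?_
  rw [PowerSeries.WithPiTopology.summable_iff_summable_coeff]
  intro d
  refine summable_of_ne_finset_zero (s := Finset.range (d + 1)) ?_
  intro n hn
  exact coeff_mockTerm_of_lt (by simpa using hn)

/-- Each coefficient of `B(q)` is a finite sum of coefficients of the summands. -/
theorem b_eq_sum (m : ℕ) :
    b m = ∑ n ∈ Finset.range (m + 1), PowerSeries.coeff m (mockTerm n) := by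
  have h := ((PowerSeries.WithPiTopology.hasSum_iff_hasSum_coeff (R := ℤ)).mp hasSum_mockB) m
  refine h.unique (hasSum_sum_of_ne_finset_zero ?_)
  intro n hn
  exact coeff_mockTerm_of_lt (by simpa using hn)

end SecondOrderMock

/-! Everything reduces to `b_four_mul_modEq`: modulo 8, the series of the `b(4n)` is ψ(q), so
`b(4n)` is 1 or 0 according to whether `8n + 1` is a square. Both claims then concern squares only.

Fine's transformation (`sum_fineTerm_eq`) turns B(q) into a sum with denominators (q;q²)²_{n+1}.
Expanding these in partial fractions (`sum_lambertTerm_evenPochInv`) and interchanging sums, a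
Bailey-pair argument, gives the Appell-Lerch form `theta_mul_sum_fineNumerator`: φ(-q²) B(q) = ∑
(-1)^k q^{2k(k+1)} (1 + q^{2k+1}) / (1 - q^{2k+1}). The even part of the right side is the Lambert
series of ψ² (`sum_lambertTerm_eq_sq`) in q², so φ(-q) ∑ b(2n) q^n = ψ(q)² = ψ(q²) φ(q). Write φ(q)
= a(q²) + 2q c(q²). Taking even parts once more, ∑ b(4n) q^n = ψ(q) (a² + 4qc²) / (a² - 4qc²) ≡ ψ(q)
mod 8.

The q-series identities are proved where q is nilpotent, so that all sums are finite, and applied in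
ℤ⟦X⟧/(X^N) for every N. -/

namespace SecondOrderMock

open Finset

/-! ### q-series identities over a ring with chosen inverses of 1 - q^m -/

section NilpotentBase

variable {R : Type*} [CommRing R]

/-- The product `(q²; q²)_n`. -/
def evenPoch (q : R) (n : ℕ) : R := ∏ j ∈ range n, (1 - q ^ (2 * (j + 1)))

/-- The product `(q; q²)_n`. -/
def oddPoch (q : R) (n : ℕ) : R := ∏ j ∈ range n, (1 - q ^ (2 * j + 1))

/-- The inverse of `(q²; q²)_n`, where `i m` stands for the inverse of `1 - q ^ m`. -/
def evenPochInv (i : ℕ → R) (n : ℕ) : R := ∏ j ∈ range n, i (2 * (j + 1))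

/-- The inverse of `(q; q²)_n`, where `i m` stands for the inverse of `1 - q ^ m`. -/
def oddPochInv (i : ℕ → R) (n : ℕ) : R := ∏ j ∈ range n, i (2 * j + 1)

/-- The inverse of `(q²; q²)_{n-k}`, read as `0` for `n < k`. -/
def evenPochInvSub (i : ℕ → R) (n k : ℕ) : R := if k ≤ n then evenPochInv i (n - k) else 0

/-- The numerators `(-q²; q²)_n q^{n(n+1)}` of the double-denominator form of `B(q)`. -/
def fineNumerator (q : R) (n : ℕ) : R :=
  (∏ j ∈ range n, (1 + q ^ (2 * (j + 1)))) * q ^ (n * (n + 1))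

/-- The summand `(-1)^k q^{k(k+1)} (1 + q^{2k+1}) / (1 - q^{2k+1})`. -/
def lambertTerm (q : R) (i : ℕ → R) (k : ℕ) : R :=
  (-1) ^ k * q ^ (k * (k + 1)) * (1 + q ^ (2 * k + 1)) * i (2 * k + 1)

/-- The summand `q^{(2j+1)n} (-q; q²)_n / (q^{2j+1}; q²)_{n+1}`. -/
def fineTerm (q : R) (i : ℕ → R) (j n : ℕ) : R :=
  q ^ ((2 * j + 1) * n) * (∏ l ∈ range n, (1 + q ^ (2 * l + 1))) *
    ∏ l ∈ range (n + 1), i (2 * (j + l) + 1)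

variable {q : R} {i : ℕ → R}

theorem evenPochInv_succ (n : ℕ) :
    evenPochInv i (n + 1) = evenPochInv i n * i (2 * (n + 1)) := prod_range_succ _ _

theorem oddPochInv_succ (n : ℕ) :
    oddPochInv i (n + 1) = oddPochInv i n * i (2 * n + 1) := prod_range_succ _ _

theorem fineNumerator_succ (n : ℕ) :
    fineNumerator q (n + 1) =
      fineNumerator q n * ((1 + q ^ (2 * (n + 1))) * q ^ (2 * (n + 1))) := by
  simp only [fineNumerator, prod_range_succ]
  rw [show (n + 1) * (n + 1 + 1) = n * (n + 1) + 2 * (n + 1) by ring, pow_add]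
  ring

variable (hi : ∀ m, i (m + 1) * (1 - q ^ (m + 1)) = 1)
include hi

theorem evenPochInv_eq_mul (n : ℕ) :
    evenPochInv i n = evenPochInv i (n + 1) * (1 - q ^ (2 * (n + 1))) := by
  rw [evenPochInv_succ, mul_assoc, show 2 * (n + 1) = 2 * n + 1 + 1 by ring, hi, mul_one]

theorem oddPochInv_eq_mul (n : ℕ) :
    oddPochInv i n = oddPochInv i (n + 1) * (1 - q ^ (2 * n + 1)) := by
  rw [oddPochInv_succ, mul_assoc, hi, mul_one]

theorem evenPochInv_mul_evenPoch (n : ℕ) : evenPochInv i n * evenPoch q n = 1 := by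
  rw [evenPochInv, evenPoch, ← prod_mul_distrib]
  exact prod_eq_one fun j _ => hi (2 * j + 1)

theorem oddPochInv_mul_oddPoch (n : ℕ) : oddPochInv i n * oddPoch q n = 1 := by
  rw [oddPochInv, oddPoch, ← prod_mul_distrib]
  exact prod_eq_one fun j _ => hi (2 * j)

theorem inv_eq_one_of_pow_eq_zero {m : ℕ} (h : q ^ (m + 1) = 0) : i (m + 1) = 1 := by
  simpa [h] using hi m

/-- At the boundary `k = n + 1` the factor 1 - q⁰ vanishes, in agreement with the convention that
1/(q²;q²)_{-1} is 0. -/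
theorem evenPochInvSub_left (n k : ℕ) (h : k ≤ n + 1) :
    evenPochInvSub i n k = (1 - q ^ (2 * (n + 1 - k))) * evenPochInvSub i (n + 1) k := by
  obtain rfl | h' := h.eq_or_lt
  · simp [evenPochInvSub]
  · obtain ⟨d, hd⟩ := Nat.exists_eq_add_of_lt h'
    obtain rfl : n = k + d := Nat.succ_injective (by omega)
    rw [evenPochInvSub, evenPochInvSub, if_pos (by omega), if_pos (by omega),
      show k + d - k = d by omega, show k + d + 1 - k = d + 1 by omega,
      evenPochInv_eq_mul hi d, mul_comm]

theorem evenPochInvSub_right (n k : ℕ) (h : k ≤ n) :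
    evenPochInvSub i n (k + 1) = (1 - q ^ (2 * (n - k))) * evenPochInvSub i n k := by
  rw [show n - k = n + 1 - (k + 1) by omega]
  have := evenPochInvSub_left hi n (k + 1) (by omega)
  rw [this]
  simp [evenPochInvSub, h]

/-- One step of Fine's transformation. -/
theorem sum_fineTerm_step {N : ℕ} (hq : q ^ N = 0) (j : ℕ) :
    ∑ n ∈ range N, fineTerm q i j n = i (2 * j + 1) ^ 2 *
      (1 + q ^ (2 * (j + 1)) * (1 + q ^ (2 * (j + 1))) * ∑ n ∈ range N, fineTerm q i (j + 1) n) := by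
  -- Summed over n, the left side is (1 - q^{2j+1}) times the sum at `j`, up to the end terms; the
  -- right side is a multiple of the sum at `j + 1`.
  have hstep : ∀ n, fineTerm q i j (n + 1) - q ^ (2 * j + 1) * fineTerm q i j n =
      i (2 * j + 1) * (q ^ (2 * (j + 1)) * (1 + q ^ (2 * (j + 1)))) * fineTerm q i (j + 1) n := by
    intro n
    have h1 : ∏ l ∈ range (n + 2), i (2 * (j + l) + 1) =
        i (2 * j + 1) * ∏ l ∈ range (n + 1), i (2 * (j + 1 + l) + 1) := by
      rw [prod_range_succ', mul_comm]
      simp only [add_zero, add_assoc, add_comm 1]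
    have h2 : ∏ l ∈ range (n + 1), i (2 * (j + l) + 1) =
        (1 - q ^ (2 * (j + n) + 3)) * ∏ l ∈ range (n + 2), i (2 * (j + l) + 1) := by
      rw [prod_range_succ _ (n + 1), show 2 * (j + (n + 1)) + 1 = 2 * (j + n) + 2 + 1 by ring]
      linear_combination -(∏ l ∈ range (n + 1), i (2 * (j + l) + 1)) * hi (2 * (j + n) + 2)
    simp only [fineTerm]
    rw [h2, h1, prod_range_succ]
    ring
  have htel := sum_range_sub (fineTerm q i j) N
  have hN : fineTerm q i j N = 0 := by
    rw [fineTerm, pow_eq_zero_of_le (by nlinarith) hq]; ring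
  have h0 : fineTerm q i j 0 = i (2 * j + 1) := by simp [fineTerm]
  have hsum := sum_congr rfl fun n (_ : n ∈ range N) => hstep n
  rw [sum_sub_distrib, ← mul_sum, ← mul_sum] at hsum
  rw [sum_sub_distrib, hN, h0] at htel
  linear_combination i (2 * j + 1) * hsum - i (2 * j + 1) * htel -
    (∑ n ∈ range N, fineTerm q i j n) * hi (2 * j)

theorem sum_fineTerm_iterate {N : ℕ} (hq : q ^ N = 0) (J : ℕ) :
    ∑ n ∈ range N, fineTerm q i 0 n =
      ∑ j ∈ range J, fineNumerator q j * oddPochInv i (j + 1) ^ 2 +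
        fineNumerator q J * oddPochInv i J ^ 2 * ∑ n ∈ range N, fineTerm q i J n := by
  induction J with
  | zero => simp [fineNumerator, oddPochInv]
  | succ J ih =>
    rw [ih, sum_range_succ, sum_fineTerm_step hi hq J, fineNumerator_succ, oddPochInv_succ]
    ring

/-- Fine's transformation of the second order mock theta function. -/
theorem sum_fineTerm_eq {N : ℕ} (hq : q ^ N = 0) :
    ∑ n ∈ range N, fineTerm q i 0 n =
      ∑ j ∈ range N, fineNumerator q j * oddPochInv i (j + 1) ^ 2 := by
  -- After N iterations the remainder carries the factor q^{N(N+1)} = 0.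
  rw [sum_fineTerm_iterate hi hq N, fineNumerator,
    pow_eq_zero_of_le (show N ≤ N * (N + 1) by nlinarith) hq]
  ring

/-! ### Partial fractions and the Appell-Lerch form -/

/-- For n > 0 the sum telescopes once multiplied by 1 - q^{2n}. This is the orthogonality relation
of a unit Bailey pair; it drives the induction for the partial fractions and also inverts the theta
function. -/
theorem sum_alternating_evenPochInv (n : ℕ) :
    ∑ k ∈ range (n + 1), (-1) ^ k * q ^ (k * (k - 1)) * (1 - q ^ (2 * (2 * k + 1))) *
      evenPochInvSub i n k * evenPochInv i (n + k + 1) = if n = 0 then 1 else 0 := by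
  obtain rfl | ⟨n, rfl⟩ : n = 0 ∨ ∃ m, n = m + 1 := by cases n <;> simp
  · simpa [evenPochInvSub, evenPochInv, mul_comm] using hi 1
  rw [if_neg (by omega)]
  set v : ℕ → R := fun k => (-1) ^ k * q ^ (k * (k - 1)) * (1 - q ^ (2 * k)) *
    evenPochInvSub i (n + 1) k * evenPochInv i (n + 1 + k) with hv
  have key : ∀ k ∈ range (n + 1 + 1),
      (1 - q ^ (2 * n + 1 + 1)) * ((-1) ^ k * q ^ (k * (k - 1)) * (1 - q ^ (2 * (2 * k + 1))) *
        evenPochInvSub i (n + 1) k * evenPochInv i (n + 1 + k + 1)) = v k - v (k + 1) := by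
    intro k hk
    obtain ⟨d, hd⟩ := Nat.exists_eq_add_of_le (Nat.lt_succ_iff.mp (mem_range.mp hk))
    have h1 := evenPochInv_eq_mul hi (n + 1 + k)
    have h2 := evenPochInvSub_right hi (n + 1) k (by omega)
    have h3 : q ^ ((k + 1) * (k + 1 - 1)) = q ^ (k * (k - 1)) * q ^ (2 * k) := by
      rw [← pow_add]; congr 1; cases k <;> simp; ring
    simp only [hv]
    rw [h1, h2, h3, show n + 1 - k = d by omega, ← add_assoc (n + 1) k 1,
      show 2 * n + 1 + 1 = 2 * (k + d) by omega, show 2 * (n + 1 + k + 1) = 2 * (k + d + k + 1) by omega]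
    ring
  have hsum := sum_congr rfl key
  rw [← mul_sum, sum_range_sub'] at hsum
  -- The lower end vanishes through 1 - q⁰, the upper end through the convention in
  -- `evenPochInvSub`.
  have hv0 : v 0 = 0 := by simp [hv]
  have hvn : v (n + 1 + 1) = 0 := by simp [hv, evenPochInvSub]
  rw [hv0, hvn, sub_zero] at hsum
  have := congrArg (i (2 * n + 1 + 1) * ·) hsum
  simpa only [← mul_assoc, hi, one_mul, mul_zero] using this

/-- The partial fraction expansion of `1 / (q; q²)_{n+1}²`. -/
theorem sum_lambertTerm_evenPochInv (n : ℕ) :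
    ∑ k ∈ range (n + 1), lambertTerm q i k * (evenPochInvSub i n k * evenPochInv i (n + k + 1)) =
      oddPochInv i (n + 1) ^ 2 := by
  induction n with
  | zero =>
    simp [lambertTerm, evenPochInvSub, evenPochInv, oddPochInv]
    have h1 := hi 0
    have h2 := hi 1
    norm_num at h1 h2
    linear_combination i 1 ^ 2 * h2 - i 1 * i 2 * (1 + q) * h1
  | succ n ih =>
    have hvan := sum_alternating_evenPochInv hi (n + 1)
    rw [if_neg (by omega)] at hvan
    -- With A = q^{2(n+1)} and x = q^{2k+1}, this is (1 - Aq)² - (1 - Aq^{-2k})(1 - Aq^{2k+2}) =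
    -- Aq^{-2k}(1 - x)², multiplied by (1 + x)/(1 - x). The right side sums to 0 over k by
    -- orthogonality.
    have key : ∀ k ∈ range (n + 1 + 1),
        (1 - q ^ (2 * (n + 1) + 1)) ^ 2 * (lambertTerm q i k *
          (evenPochInvSub i (n + 1) k * evenPochInv i (n + 1 + k + 1))) -
        lambertTerm q i k * (evenPochInvSub i n k * evenPochInv i (n + k + 1)) =
        q ^ (2 * (n + 1)) * ((-1) ^ k * q ^ (k * (k - 1)) * (1 - q ^ (2 * (2 * k + 1))) *
          evenPochInvSub i (n + 1) k * evenPochInv i (n + 1 + k + 1)) := by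
      intro k hk
      have hk' : k ≤ n + 1 := Nat.lt_succ_iff.mp (mem_range.mp hk)
      obtain ⟨d, hd⟩ := Nat.exists_eq_add_of_le hk'
      have h1 := evenPochInv_eq_mul hi (n + k + 1)
      have h2 := evenPochInvSub_left hi n k hk'
      have h3 : q ^ (k * (k + 1)) = q ^ (k * (k - 1)) * q ^ (2 * k) := by
        rw [← pow_add]; congr 1; cases k <;> simp; ring
      have h4 := hi (2 * k)
      rw [h1, h2, lambertTerm, h3, show n + 1 + k + 1 = n + k + 1 + 1 by ring,
        show n + 1 - k = d by omega, show 2 * (n + k + 1 + 1) = 2 * (k + d + k + 1) by omega,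
        hd]
      linear_combination ((-1) ^ k * q ^ (k * (k - 1)) * q ^ (2 * k + 2 * d) *
        (1 - q ^ (2 * (2 * k + 1))) * evenPochInvSub i (k + d) k * evenPochInv i (n + k + 1 + 1)) * h4
    have hsum := sum_congr rfl key
    rw [← mul_sum, hvan, mul_zero, sum_sub_distrib, ← mul_sum,
      sum_range_succ _ (n + 1)] at hsum
    have hlast : evenPochInvSub i n (n + 1) = 0 := by simp [evenPochInvSub]
    rw [sum_range_succ (fun k => lambertTerm q i k *
      (evenPochInvSub i n k * evenPochInv i (n + k + 1))), ih, hlast, ← sum_range_succ] at hsum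
    rw [oddPochInv_eq_mul hi (n + 1)] at hsum
    have h1 := hi (2 * (n + 1))
    set S := ∑ k ∈ range (n + 1 + 1), lambertTerm q i k *
          (evenPochInvSub i (n + 1) k * evenPochInv i (n + 1 + k + 1))
    have h2 : (1 - q ^ (2 * (n + 1) + 1)) ^ 2 * (S - oddPochInv i (n + 1 + 1) ^ 2) = 0 := by
      linear_combination hsum
    have h3 := congrArg (i (2 * (n + 1) + 1) ^ 2 * ·) h2
    simp only [mul_zero, ← mul_assoc, ← mul_pow, h1, one_pow, one_mul] at h3
    exact sub_eq_zero.mp h3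

/-- The difference of the two sides telescopes in n. The end at 0 vanishes by convention, the end at
M because `fineNumerator q M` contains q^{M(M+1)}. -/
theorem sum_fineNumerator_step {M : ℕ} (hq : q ^ (M * (M + 1)) = 0) (k : ℕ) :
    ∑ n ∈ range M, fineNumerator q n *
        (evenPochInvSub i n (k + 1) * evenPochInv i (n + (k + 1) + 1)) =
      q ^ (2 * (k + 1)) *
        ∑ n ∈ range M, fineNumerator q n * (evenPochInvSub i n k * evenPochInv i (n + k + 1)) := by
  set g : ℕ → R := fun n => fineNumerator q n *
    (evenPochInvSub i n (k + 1) * evenPochInv i (n + k + 1)) with hg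
  have key : ∀ n, q ^ (2 * (k + 1)) * (fineNumerator q n *
      (evenPochInvSub i n k * evenPochInv i (n + k + 1))) -
      fineNumerator q n * (evenPochInvSub i n (k + 1) * evenPochInv i (n + (k + 1) + 1)) =
      (1 - q ^ (2 * (k + 1))) * (g (n + 1) - g n) := by
    intro n
    simp only [hg]
    rcases lt_or_ge n k with h | h
    · simp [evenPochInvSub, show ¬ k ≤ n by omega, show ¬ k + 1 ≤ n by omega]
    · obtain ⟨d, rfl⟩ := Nat.exists_eq_add_of_le h
      have h1 := evenPochInv_eq_mul hi (k + d + k + 1)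
      have h2 := evenPochInvSub_right hi (k + d) k h
      have h3 : evenPochInvSub i (k + d + 1) (k + 1) = evenPochInvSub i (k + d) k := by
        simp [evenPochInvSub]
      rw [h3, h2, fineNumerator_succ, show k + d - k = d by omega,
        show k + d + (k + 1) + 1 = k + d + k + 1 + 1 by ring,
        show k + d + 1 + k + 1 = k + d + k + 1 + 1 by ring, h1]
      ring
  have hsum := sum_congr rfl fun n (_ : n ∈ range M) => key n
  rw [sum_sub_distrib, ← mul_sum, ← mul_sum, sum_range_sub] at hsum
  have h0 : g 0 = 0 := by simp [hg, evenPochInvSub]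
  have hM : g M = 0 := by simp [hg, fineNumerator, hq]
  rw [h0, hM] at hsum
  linear_combination -hsum

/-- The inner sum depends on k only through q^{k(k+1)}; the common factor, its value at k = 0,
cancels later without being evaluated as a product. -/
theorem sum_fineNumerator_eq_pow_mul {M : ℕ} (hq : q ^ (M * (M + 1)) = 0) (k : ℕ) :
    ∑ n ∈ range M, fineNumerator q n * (evenPochInvSub i n k * evenPochInv i (n + k + 1)) =
      q ^ (k * (k + 1)) *
        ∑ n ∈ range M, fineNumerator q n * (evenPochInvSub i n 0 * evenPochInv i (n + 0 + 1)) := by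
  induction k with
  | zero => simp
  | succ k ih =>
    rw [sum_fineNumerator_step hi hq, ih, ← mul_assoc, ← pow_add]
    congr 2
    ring

-- The added terms are zero; a range independent of n allows the sums to be interchanged.
omit hi in
theorem sum_range_extend_evenPochInvSub (f : ℕ → ℕ → R) {n M : ℕ} (h : n < M) :
    ∑ k ∈ range (n + 1), f n k * evenPochInvSub i n k =
      ∑ k ∈ range M, f n k * evenPochInvSub i n k := by
  refine sum_subset (range_mono h) fun k _ hk => ?_
  rw [evenPochInvSub, if_neg (by simpa using hk), mul_zero]

/-- The Appell-Lerch form of the second order mock theta function. -/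
theorem theta_mul_sum_fineNumerator {M : ℕ} (hM : 0 < M) (hq : q ^ (M * (M + 1)) = 0) :
    (∑ k ∈ range M, (-1) ^ k * (q ^ (2 * k ^ 2) - q ^ (2 * (k + 1) ^ 2))) *
      ∑ n ∈ range M, fineNumerator q n * oddPochInv i (n + 1) ^ 2 =
    ∑ k ∈ range M, lambertTerm q i k * q ^ (k * (k + 1)) := by
  set E : R :=
    ∑ n ∈ range M, fineNumerator q n * (evenPochInvSub i n 0 * evenPochInv i (n + 0 + 1)) with hE
  have hB : ∑ n ∈ range M, fineNumerator q n * oddPochInv i (n + 1) ^ 2 =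
      (∑ k ∈ range M, lambertTerm q i k * q ^ (k * (k + 1))) * E := by
    calc ∑ n ∈ range M, fineNumerator q n * oddPochInv i (n + 1) ^ 2
        = ∑ n ∈ range M, ∑ k ∈ range M, fineNumerator q n *
            (lambertTerm q i k * (evenPochInvSub i n k * evenPochInv i (n + k + 1))) := by
          refine sum_congr rfl fun n hn => ?_
          rw [← sum_lambertTerm_evenPochInv hi n, mul_sum]
          have := sum_range_extend_evenPochInvSub (i := i)
            (fun n k => fineNumerator q n * (lambertTerm q i k * evenPochInv i (n + k + 1)))
            (mem_range.mp hn)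
          convert this using 2 <;> ring
      _ = ∑ k ∈ range M, lambertTerm q i k * ∑ n ∈ range M, fineNumerator q n *
            (evenPochInvSub i n k * evenPochInv i (n + k + 1)) := by
          rw [sum_comm]
          refine sum_congr rfl fun k _ => ?_
          rw [mul_sum]
          exact sum_congr rfl fun n _ => by ring
      _ = _ := by
          rw [sum_mul]
          refine sum_congr rfl fun k _ => ?_
          rw [sum_fineNumerator_eq_pow_mul hi hq k]
          ring
  -- Pairing the orthogonality relation with the numerators shows that E is the inverse of the
  -- truncated φ(-q²).
  have hone : (∑ k ∈ range M, (-1) ^ k * (q ^ (2 * k ^ 2) - q ^ (2 * (k + 1) ^ 2))) * E = 1 := by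
    symm
    calc (1 : R) = ∑ n ∈ range M, fineNumerator q n * (if n = 0 then 1 else 0) := by
          simp [hM, fineNumerator]
      _ = ∑ n ∈ range M, ∑ k ∈ range M, fineNumerator q n *
            ((-1) ^ k * q ^ (k * (k - 1)) * (1 - q ^ (2 * (2 * k + 1))) *
              evenPochInvSub i n k * evenPochInv i (n + k + 1)) := by
          refine sum_congr rfl fun n hn => ?_
          rw [← sum_alternating_evenPochInv hi n, mul_sum]
          have := sum_range_extend_evenPochInvSub (i := i)
            (fun n k => fineNumerator q n * ((-1) ^ k * q ^ (k * (k - 1)) *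
              (1 - q ^ (2 * (2 * k + 1))) * evenPochInv i (n + k + 1)))
            (mem_range.mp hn)
          convert this using 2 <;> ring
      _ = ∑ k ∈ range M, (-1) ^ k * q ^ (k * (k - 1)) * (1 - q ^ (2 * (2 * k + 1))) *
            ∑ n ∈ range M, fineNumerator q n *
              (evenPochInvSub i n k * evenPochInv i (n + k + 1)) := by
          rw [sum_comm]
          refine sum_congr rfl fun k _ => ?_
          rw [mul_sum]
          exact sum_congr rfl fun n _ => by ring
      _ = _ := by
          rw [sum_mul]
          refine sum_congr rfl fun k _ => ?_
          rw [sum_fineNumerator_eq_pow_mul hi hq k]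
          have h3 : q ^ (2 * k ^ 2) = q ^ (k * (k - 1)) * q ^ (k * (k + 1)) := by
            rw [← pow_add]; congr 1; cases k <;> simp; ring
          have h4 : q ^ (2 * (k + 1) ^ 2) =
              q ^ (k * (k - 1)) * q ^ (k * (k + 1)) * q ^ (2 * (2 * k + 1)) := by
            rw [← h3, ← pow_add]; congr 1; ring
          rw [h3, h4]
          ring
  rw [hB]
  linear_combination (∑ k ∈ range M, lambertTerm q i k * q ^ (k * (k + 1))) * hone

/-! ### Gauss' product for ψ and the Lambert series of ψ² -/

/-- Shanks' finite form of Gauss' identity for triangular numbers. -/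
theorem sum_shanks (n : ℕ) :
    ∑ s ∈ range n, oddPochInv i n * evenPoch q n * (evenPochInv i s * oddPoch q s) *
      q ^ (s * (2 * n + 1)) = ∑ s ∈ range (2 * n), q ^ (s * (s + 1) / 2) := by
  induction n with
  | zero => simp
  | succ n ih =>
    have hone : ∀ m, oddPochInv i m * evenPoch q m * (evenPochInv i m * oddPoch q m) = 1 := by
      intro m
      linear_combination evenPochInv_mul_evenPoch hi m * (oddPochInv i m * oddPoch q m) +
        oddPochInv_mul_oddPoch hi m
    set G : ℕ → R := fun s => i (2 * n + 1) * (oddPochInv i n * evenPoch q n *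
      (evenPochInv i s * oddPoch q s)) * (1 - q ^ (2 * s)) * q ^ (s * (2 * n + 1)) with hG
    -- The two new triangular exponents come from the ends: the diagonal term s = n gives n(2n+1),
    -- and `G (n + 1)` gives (n+1)(2n+1).
    have key : ∀ s, oddPochInv i (n + 1) * evenPoch q (n + 1) * (evenPochInv i s * oddPoch q s) *
        q ^ (s * (2 * (n + 1) + 1)) - oddPochInv i n * evenPoch q n *
        (evenPochInv i s * oddPoch q s) * q ^ (s * (2 * n + 1)) = G (s + 1) - G s := by
      intro s
      have h1 := evenPochInv_eq_mul hi s
      have h2 : oddPoch q (s + 1) = oddPoch q s * (1 - q ^ (2 * s + 1)) := prod_range_succ _ _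
      have h3 : evenPoch q (n + 1) = evenPoch q n * (1 - q ^ (2 * (n + 1))) := prod_range_succ _ _
      have h4 := hi (2 * n)
      simp only [hG]
      rw [h1, h2, h3, oddPochInv_succ]
      linear_combination (oddPochInv i n * evenPoch q n * (evenPochInv i (s + 1) *
        (1 - q ^ (2 * (s + 1))) * oddPoch q s) * q ^ (s * (2 * n + 1))) * h4
    have hsum := sum_congr rfl fun s (_ : s ∈ range (n + 1)) => key s
    rw [sum_sub_distrib, sum_range_sub, sum_range_succ (fun s => oddPochInv i n * evenPoch q n *
        (evenPochInv i s * oddPoch q s) * q ^ (s * (2 * n + 1))), ih, hone n] at hsum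
    have hG0 : G 0 = 0 := by simp [hG]
    have hGn : G (n + 1) = q ^ ((n + 1) * (2 * n + 1)) := by
      have h1 := evenPochInv_eq_mul hi n
      have h2 : oddPoch q (n + 1) = oddPoch q n * (1 - q ^ (2 * n + 1)) := prod_range_succ _ _
      have h3 := hone n
      rw [h1] at h3
      simp only [hG]
      rw [h2]
      linear_combination q ^ ((n + 1) * (2 * n + 1)) * i (2 * n + 1) * (1 - q ^ (2 * n + 1)) * h3 +
        q ^ ((n + 1) * (2 * n + 1)) * hi (2 * n)
    rw [hG0, hGn] at hsum
    rw [show 2 * (n + 1) = 2 * n + 1 + 1 by ring, sum_range_succ _ (2 * n + 1),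
      sum_range_succ _ (2 * n),
      show 2 * n * (2 * n + 1) / 2 = n * (2 * n + 1) by
        rw [mul_assoc, Nat.mul_div_cancel_left _ two_pos],
      show (2 * n + 1) * (2 * n + 1 + 1) / 2 = (n + 1) * (2 * n + 1) by
        rw [show (2 * n + 1) * (2 * n + 1 + 1) = 2 * ((n + 1) * (2 * n + 1)) by ring,
          Nat.mul_div_cancel_left _ two_pos]]
    rw [show 2 * (n + 1) + 1 = 2 * n + 1 + 1 + 1 by ring] at hsum
    linear_combination hsum

/-- All later factors are 1, so the product at N plays the role of the infinite product. -/
theorem evenPochInv_add {N : ℕ} (hq : q ^ N = 0) (d : ℕ) :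
    evenPochInv i (N + d) = evenPochInv i N := by
  induction d with
  | zero => rfl
  | succ d ih =>
    rw [← add_assoc, evenPochInv_succ, ih, show 2 * (N + d + 1) = 2 * (N + d) + 1 + 1 by ring,
      inv_eq_one_of_pow_eq_zero hi (pow_eq_zero_of_le (by omega) hq), mul_one]

theorem oddPochInv_add {N : ℕ} (hq : q ^ N = 0) (d : ℕ) :
    oddPochInv i (N + d) = oddPochInv i N := by
  induction d with
  | zero => rfl
  | succ d ih =>
    rw [← add_assoc, oddPochInv_succ, ih,
      inv_eq_one_of_pow_eq_zero hi (pow_eq_zero_of_le (by omega) hq), mul_one]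

/-- This is Gauss' ψ(q) = (q²;q²)_∞ / (q;q²)_∞: in Shanks' sum only s = 0 survives. -/
theorem oddPochInv_mul_evenPoch {N : ℕ} (hN : 0 < N) (hq : q ^ N = 0) :
    oddPochInv i N * evenPoch q N = ∑ s ∈ range (2 * N), q ^ (s * (s + 1) / 2) := by
  rw [← sum_shanks hi N, sum_eq_single_of_mem 0 (mem_range.mpr hN)]
  · simp [evenPochInv, oddPoch]
  · intro s _ hs
    rw [pow_eq_zero_of_le (show N ≤ s * (2 * N + 1) by
      nlinarith [Nat.pos_of_ne_zero hs]) hq, mul_zero]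

/-- The Lambert series of the square of `∑ q^{s(s+1)/2}`. -/
theorem sum_lambertTerm_eq_sq {N : ℕ} (hN : 0 < N) (hq : q ^ N = 0) :
    ∑ k ∈ range N, lambertTerm q i k = (∑ s ∈ range (2 * N), q ^ (s * (s + 1) / 2)) ^ 2 := by
  -- At n = 2N both products have index at least N whenever k < N, so they no longer depend on k;
  -- the terms with k ≥ N vanish.
  have h := sum_lambertTerm_evenPochInv hi (N + N)
  rw [← sum_subset (range_mono (show N ≤ N + N + 1 by omega))] at h
  · have h' : ∀ k ∈ range N, lambertTerm q i k *
        (evenPochInvSub i (N + N) k * evenPochInv i (N + N + k + 1)) =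
        lambertTerm q i k * evenPochInv i N ^ 2 := by
      intro k hk
      have hk := mem_range.mp hk
      rw [evenPochInvSub, if_pos (by omega), show N + N - k = N + (N - k) by omega,
        evenPochInv_add hi hq, show N + N + k + 1 = N + (N + k + 1) by ring,
        evenPochInv_add hi hq, sq]
    rw [sum_congr rfl h', ← sum_mul, add_assoc, oddPochInv_add hi hq] at h
    rw [← oddPochInv_mul_evenPoch hi hN hq]
    linear_combination evenPoch q N ^ 2 * h - (∑ k ∈ range N, lambertTerm q i k) *
      (evenPochInv i N * evenPoch q N + 1) * evenPochInv_mul_evenPoch hi N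
  · intro k _ hk
    have hk : N ≤ k := by simpa using hk
    rw [lambertTerm, pow_eq_zero_of_le (show N ≤ k * (k + 1) by nlinarith) hq]
    ring

end NilpotentBase

end SecondOrderMock

namespace SecondOrderMock

open Finset PowerSeries

/-! ### Theta functions as counting series -/

/-- The power series `∑_a X ^ f a`, for `f` with finite fibres. -/
noncomputable def countingSeries {α : Type*} (f : α → ℕ) : ℤ⟦X⟧ :=
  PowerSeries.mk fun n => (Nat.card {a // f a = n} : ℤ)

theorem countingSeries_comp {α β : Type*} (e : α ≃ β) (f : β → ℕ) :
    countingSeries (fun a => f (e a)) = countingSeries f := by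
  ext n
  simp only [countingSeries, coeff_mk]
  exact congrArg _ (Nat.card_congr (e.subtypeEquiv fun _ => Iff.rfl))

theorem countingSeries_mul {α β : Type*} (f : α → ℕ) (g : β → ℕ)
    (hf : ∀ n, Finite {a // f a = n}) (hg : ∀ n, Finite {b // g b = n}) :
    countingSeries f * countingSeries g = countingSeries fun p : α × β => f p.1 + g p.2 := by
  ext n
  simp only [countingSeries, coeff_mul, coeff_mk]
  let e : {p : α × β // f p.1 + g p.2 = n} ≃
      (Σ x : antidiagonal n, {a // f a = x.1.1} × {b // g b = x.1.2}) :=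
    { toFun := fun p => ⟨⟨(f p.1.1, g p.1.2), mem_antidiagonal.mpr p.2⟩, ⟨p.1.1, rfl⟩, ⟨p.1.2, rfl⟩⟩
      invFun := fun x => ⟨(x.2.1.1, x.2.2.1), by
        rw [x.2.1.2, x.2.2.2]; exact mem_antidiagonal.mp x.1.2⟩
      left_inv := fun _ => rfl
      right_inv := by
        rintro ⟨⟨⟨i, j⟩, h⟩, ⟨a, ha⟩, ⟨b, hb⟩⟩
        dsimp only at ha hb
        subst ha hb
        rfl }
  rw [Nat.card_congr e, Nat.card_sigma]
  simp only [Nat.card_prod]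
  push_cast
  exact (sum_coe_sort (antidiagonal n)
    fun x => (Nat.card {a // f a = x.1} : ℤ) * Nat.card {b // g b = x.2}).symm

theorem expand_countingSeries {α : Type*} (f : α → ℕ) :
    expand 2 two_ne_zero (countingSeries f) = countingSeries fun a => 2 * f a := by
  ext n
  rw [coeff_expand]
  simp only [countingSeries, coeff_mk]
  split_ifs with h
  · obtain ⟨m, rfl⟩ := h
    simp
  · have : IsEmpty {a // 2 * f a = n} := ⟨fun a => h ⟨_, a.2.symm⟩⟩
    simp

/-- Ramanujan's theta function `φ(q) = ∑_{z ∈ ℤ} q^{z²}`. -/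
noncomputable def thetaPhi : ℤ⟦X⟧ := countingSeries fun z : ℤ => z.natAbs ^ 2

/-- Ramanujan's theta function `ψ(q) = ∑_{n ≥ 0} q^{n(n+1)/2}`. -/
noncomputable def thetaPsi : ℤ⟦X⟧ := countingSeries fun n : ℕ => n * (n + 1) / 2

/-- The theta function `φ(-q)`. -/
noncomputable def thetaPhiNeg : ℤ⟦X⟧ := PowerSeries.mk fun n => (-1) ^ n * coeff n thetaPhi

theorem two_mul_triangle (n : ℕ) : 2 * (n * (n + 1) / 2) = n * (n + 1) :=
  Nat.mul_div_cancel' (Nat.even_mul_succ_self n).two_dvd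

theorem triangle_injective : Function.Injective fun n : ℕ => n * (n + 1) / 2 := by
  intro a b h
  have h' : a * (a + 1) = b * (b + 1) := by
    rw [← two_mul_triangle a, ← two_mul_triangle b]
    exact congrArg (2 * ·) h
  nlinarith [lt_trichotomy a b]

theorem le_triangle (n : ℕ) : n ≤ n * (n + 1) / 2 := by
  have h := two_mul_triangle n
  rcases n with _ | n
  · simp
  · nlinarith

theorem exists_triangle_eq_iff (m : ℕ) :
    (∃ n : ℕ, n * (n + 1) / 2 = m) ↔ IsSquare (8 * m + 1) := by
  constructor
  · rintro ⟨k, rfl⟩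
    exact ⟨2 * k + 1, by linarith [two_mul_triangle k]⟩
  · rintro ⟨r, hr⟩
    obtain ⟨k, rfl | rfl⟩ := Nat.even_or_odd' r
    · have : 8 * m + 1 = 2 * (k * (2 * k)) := by linarith
      omega
    · exact ⟨k, by linarith [two_mul_triangle k]⟩

theorem coeff_thetaPsi (m : ℕ) :
    coeff m thetaPsi = if IsSquare (8 * m + 1) then 1 else 0 := by
  simp only [thetaPsi, countingSeries, coeff_mk]
  by_cases h : ∃ n : ℕ, n * (n + 1) / 2 = m
  · obtain ⟨n, rfl⟩ := h
    rw [if_pos ((exists_triangle_eq_iff _).mp ⟨n, rfl⟩)]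
    have : Unique {a : ℕ // a * (a + 1) / 2 = n * (n + 1) / 2} :=
      { default := ⟨n, rfl⟩
        uniq := fun a => Subtype.ext (triangle_injective a.2) }
    simp
  · rw [if_neg (mt (exists_triangle_eq_iff m).mpr h)]
    have : IsEmpty {a : ℕ // a * (a + 1) / 2 = m} := ⟨fun a => h ⟨a, a.2⟩⟩
    simp

theorem coeff_sq_thetaPhi (k : ℕ) : coeff (k ^ 2) thetaPhi = if k = 0 then 1 else 2 := by
  simp only [thetaPhi, countingSeries, coeff_mk]
  have h : {z : ℤ | z.natAbs ^ 2 = k ^ 2} = {(k : ℤ), -(k : ℤ)} := by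
    ext z
    simp only [Set.mem_ofPred_eq, Set.mem_insert_iff, Set.mem_singleton_iff]
    rw [Nat.pow_left_inj two_ne_zero]
    omega
  have h' : Nat.card {z : ℤ // z.natAbs ^ 2 = k ^ 2} = ({(k : ℤ), -(k : ℤ)} : Set ℤ).ncard := by
    rw [← h]; rfl
  rw [h']
  split_ifs with hk
  · simp [hk]
  · rw [Set.ncard_pair (by omega)]
    rfl

theorem coeff_thetaPhi_of_not_isSquare {m : ℕ} (h : ∀ k, m ≠ k ^ 2) : coeff m thetaPhi = 0 := by
  simp only [thetaPhi, countingSeries, coeff_mk]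
  have : IsEmpty {z : ℤ // z.natAbs ^ 2 = m} := ⟨fun z => h _ z.2.symm⟩
  simp

theorem even_coeff_thetaPhi (m : ℕ) : 2 ∣ coeff (2 * m + 1) thetaPhi := by
  by_cases h : ∃ k, 2 * m + 1 = k ^ 2
  · obtain ⟨k, hk⟩ := h
    rw [hk, coeff_sq_thetaPhi, if_neg]
    rintro rfl
    simp at hk
  · rw [coeff_thetaPhi_of_not_isSquare (by simpa using h)]
    exact dvd_zero 2

/-- The correspondence between representations `N = a(a+1)/2 + b(b+1)/2` and
`N = j(j+1) + z²`. -/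
def trianglePairEquiv : ℕ × ℕ ≃ ℕ × ℤ where
  toFun p :=
    -- For equal parity, (a, b) goes to half its sum and half its difference. Otherwise the smaller
    -- entry c is first replaced by -1 - c, which keeps c(c+1), corrects the parity and leaves the
    -- sum nonnegative.
    if (p.1 + p.2) % 2 = 0 then ((p.1 + p.2) / 2, ((p.1 : ℤ) - p.2) / 2)
    else if p.2 < p.1 then ((p.1 - p.2 - 1) / 2, ((p.1 : ℤ) + p.2 + 1) / 2)
    else ((p.2 - p.1 - 1) / 2, -(((p.1 : ℤ) + p.2 + 1) / 2))
  invFun p :=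
    if p.2.natAbs ≤ p.1 then (((p.1 : ℤ) + p.2).toNat, ((p.1 : ℤ) - p.2).toNat)
    else if 0 < p.2 then ((p.2 + p.1).toNat, (p.2 - p.1 - 1).toNat)
    else ((-p.2 - p.1 - 1).toNat, (-p.2 + p.1).toNat)
  left_inv := by
    rintro ⟨a, b⟩
    dsimp only
    split_ifs <;> simp only [Prod.mk.injEq] at * <;> constructor <;> omega
  right_inv := by
    rintro ⟨j, z⟩
    dsimp only
    split_ifs <;> simp only [Prod.mk.injEq] at * <;> constructor <;> omega

theorem trianglePairEquiv_symm_sum (j : ℕ) (z : ℤ) :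
    (trianglePairEquiv.symm (j, z)).1 * ((trianglePairEquiv.symm (j, z)).1 + 1) +
      (trianglePairEquiv.symm (j, z)).2 * ((trianglePairEquiv.symm (j, z)).2 + 1) =
    2 * (j * (j + 1) + z.natAbs ^ 2) := by
  have key : ∀ a b : ℕ, ((a : ℤ) * (a + 1) + b * (b + 1) = 2 * (j * (j + 1) + z ^ 2)) →
      a * (a + 1) + b * (b + 1) = 2 * (j * (j + 1) + z.natAbs ^ 2) := by
    intro a b h
    zify
    rw [sq_abs]
    exact h
  apply key
  simp only [trianglePairEquiv, Equiv.coe_fn_symm_mk]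
  split_ifs <;> simp only []
  · rw [Int.toNat_of_nonneg (by omega), Int.toNat_of_nonneg (by omega)]; ring
  · rw [Int.toNat_of_nonneg (by omega), Int.toNat_of_nonneg (by omega)]; ring
  · rw [Int.toNat_of_nonneg (by omega), Int.toNat_of_nonneg (by omega)]; ring

theorem finite_triangle_fibre (n : ℕ) : Finite {a : ℕ // a * (a + 1) / 2 = n} :=
  Finite.of_injective (fun _ => ()) fun a b _ => Subtype.ext (triangle_injective (a.2.trans b.2.symm))

theorem thetaPsi_sq : thetaPsi ^ 2 = expand 2 two_ne_zero thetaPsi * thetaPhi := by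
  rw [sq, thetaPsi, countingSeries_mul _ _ finite_triangle_fibre finite_triangle_fibre,
    expand_countingSeries, thetaPhi, countingSeries_mul]
  · rw [← countingSeries_comp trianglePairEquiv.symm]
    congr 1
    funext p
    have h := trianglePairEquiv_symm_sum p.1 p.2
    have h1 := two_mul_triangle (trianglePairEquiv.symm p).1
    have h2 := two_mul_triangle (trianglePairEquiv.symm p).2
    have h3 := two_mul_triangle p.1
    simp only [Prod.mk.eta] at h
    omega
  · intro n
    refine Finite.of_injective (fun _ => ()) fun a b _ => Subtype.ext (triangle_injective ?_)
    have := a.2.trans b.2.symm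
    dsimp only at this ⊢
    omega
  · intro n
    refine Finite.of_injective (β := Finset.Icc (-(n : ℤ)) n)
      (fun z => ⟨z.1, mem_Icc.mpr ?_⟩) fun a b h => Subtype.ext (by simpa using h)
    have := Nat.le_self_pow two_ne_zero z.1.natAbs
    have := z.2
    omega

theorem X_pow_dvd_thetaPsi_sub (N : ℕ) :
    (X : ℤ⟦X⟧) ^ N ∣ thetaPsi - ∑ s ∈ range N, X ^ (s * (s + 1) / 2) := by
  rw [X_pow_dvd_iff]
  intro m hm
  simp only [map_sub, map_sum, coeff_X_pow, coeff_thetaPsi]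
  by_cases h : ∃ n : ℕ, n * (n + 1) / 2 = m
  · obtain ⟨n, rfl⟩ := h
    rw [if_pos ((exists_triangle_eq_iff _).mp ⟨n, rfl⟩),
      sum_eq_single_of_mem n (mem_range.mpr ((le_triangle n).trans_lt hm)), if_pos rfl, sub_self]
    exact fun s _ hs => if_neg fun h => hs (triangle_injective h.symm)
  · rw [if_neg (mt (exists_triangle_eq_iff m).mpr h), sum_eq_zero, sub_self]
    exact fun s _ => if_neg fun h' => h ⟨s, h'.symm⟩

/-- Summation by parts relates the differences in `theta_mul_sum_fineNumerator` to the usual 1 + 2∑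
form of φ(-q); for x k = q^{k²} the boundary term has high order. -/
theorem sum_alternating_sub {R : Type*} [CommRing R] (x : ℕ → R) (M : ℕ) :
    ∑ k ∈ range (M + 1), (-1) ^ k * (x k - x (k + 1)) =
      ∑ k ∈ range (M + 1), (-1) ^ k * (if k = 0 then 1 else 2) * x k + (-1) ^ (M + 1) * x (M + 1) := by
  induction M with
  | zero => simp [sub_eq_add_neg]
  | succ M ih =>
    rw [sum_range_succ, ih, sum_range_succ _ (M + 1), if_neg (by omega)]
    ring

theorem X_pow_dvd_thetaPhiNeg_sub (N : ℕ) :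
    (X : ℤ⟦X⟧) ^ N ∣ thetaPhiNeg - ∑ k ∈ range N, (-1) ^ k * (X ^ k ^ 2 - X ^ (k + 1) ^ 2) := by
  rcases N with _ | N
  · simp
  rw [sum_alternating_sub fun k => (X : ℤ⟦X⟧) ^ k ^ 2, ← sub_sub]
  refine dvd_sub ?_ (Dvd.dvd.mul_left (pow_dvd_pow _ (Nat.le_self_pow two_ne_zero _)) _)
  rw [X_pow_dvd_iff]
  intro m hm
  have hterm : ∀ k : ℕ, coeff m ((-1) ^ k * (if k = 0 then 1 else 2) * X ^ k ^ 2 : ℤ⟦X⟧) =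
      if m = k ^ 2 then (-1) ^ k * (if k = 0 then 1 else 2) else 0 := by
    intro k
    have : ((-1) ^ k * (if k = 0 then 1 else 2) : ℤ⟦X⟧) =
        C ((-1) ^ k * (if k = 0 then 1 else 2) : ℤ) := by
      split_ifs <;> simp
    rw [this, coeff_C_mul, coeff_X_pow]
    simp
  simp only [map_sub, map_sum, hterm, thetaPhiNeg, coeff_mk]
  by_cases h : ∃ k, m = k ^ 2
  · obtain ⟨r, rfl⟩ := h
    rw [sum_eq_single_of_mem r
      (mem_range.mpr ((Nat.le_self_pow two_ne_zero r).trans_lt hm)), if_pos rfl, coeff_sq_thetaPhi]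
    -- The signs agree because r² and r have the same parity.
    · rw [sub_eq_zero, sq, pow_mul]
      congr 1
      rcases Nat.even_or_odd r with hr | hr
      · simp [hr.neg_one_pow]
      · simp [hr.neg_one_pow]
    · exact fun s _ hs => if_neg fun h => hs ((Nat.pow_left_inj two_ne_zero).mp h).symm
  · rw [coeff_thetaPhi_of_not_isSquare (by simpa using h), sum_eq_zero, mul_zero, sub_self]
    exact fun s _ => if_neg fun h' => h ⟨s, h'⟩

/-! ### Transfer to ℤ⟦X⟧ through the quotients by X^N -/

/-- The inverse of `1 - X ^ m`, for `m > 0`. -/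
noncomputable def geomSeries (m : ℕ) : ℤ⟦X⟧ := invOfUnit (1 - X ^ m) 1

theorem geomSeries_mul (m : ℕ) : geomSeries (m + 1) * (1 - X ^ (m + 1)) = 1 :=
  invOfUnit_mul _ _ (by simp)

theorem one_sub_X_pow_ne_zero (m : ℕ) : (1 - X ^ (m + 1) : ℤ⟦X⟧) ≠ 0 :=
  right_ne_zero_of_mul_eq_one (geomSeries_mul m)

theorem mockTerm_eq_fineTerm (n : ℕ) : mockTerm n = fineTerm X geomSeries 0 n := by
  have hprod : (∏ l ∈ range (n + 1), geomSeries (2 * (0 + l) + 1)) *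
      qPoch X (X ^ 2) (n + 1) = 1 := by
    rw [qPoch, ← prod_mul_distrib]
    refine prod_eq_one fun j _ => ?_
    rw [zero_add, ← pow_mul, ← pow_succ', geomSeries_mul]
  have hne : qPoch (X : ℤ⟦X⟧) (X ^ 2) (n + 1) ≠ 0 := right_ne_zero_of_mul_eq_one hprod
  apply mul_right_cancel₀ hne
  rw [mockTerm_mul, fineTerm, mul_assoc, hprod, mul_one]
  simp only [qPoch, mul_zero, zero_add, one_mul, neg_mul, sub_neg_eq_add, ← pow_mul, ← pow_succ']

theorem X_pow_dvd_mockB_sub (N : ℕ) :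
    (X : ℤ⟦X⟧) ^ N ∣ mockB - ∑ n ∈ range N, mockTerm n := by
  rw [X_pow_dvd_iff]
  intro m hm
  rw [map_sub, map_sum, sub_eq_zero]
  refine (b_eq_sum m).trans (sum_subset (range_mono hm) fun n _ hn => ?_)
  exact coeff_mockTerm_of_lt (by simpa using hn)

theorem map_lambertTerm {R S : Type*} [CommRing R] [CommRing S] (f : R →+* S) (q : R) (i : ℕ → R)
    (k : ℕ) : lambertTerm (f q) (fun m => f (i m)) k = f (lambertTerm q i k) := by
  simp [lambertTerm]

theorem map_fineTerm {R S : Type*} [CommRing R] [CommRing S] (f : R →+* S) (q : R) (i : ℕ → R)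
    (j n : ℕ) : fineTerm (f q) (fun m => f (i m)) j n = f (fineTerm q i j n) := by
  simp [fineTerm]

theorem mk_eq_mk_iff_X_pow_dvd {N : ℕ} {f g : ℤ⟦X⟧} :
    Ideal.Quotient.mk (Ideal.span {X ^ N}) f = Ideal.Quotient.mk (Ideal.span {X ^ N}) g ↔
      X ^ N ∣ f - g := by
  rw [Ideal.Quotient.mk_eq_mk_iff_sub_mem, Ideal.mem_span_singleton]

theorem mk_X_pow_eq_zero (N : ℕ) :
    (Ideal.Quotient.mk (Ideal.span {(X : ℤ⟦X⟧) ^ N}) X) ^ N = 0 := by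
  rw [← map_pow, Ideal.Quotient.eq_zero_iff_mem]
  exact Ideal.mem_span_singleton_self _

theorem mk_geomSeries_mul (N m : ℕ) :
    Ideal.Quotient.mk (Ideal.span {(X : ℤ⟦X⟧) ^ N}) (geomSeries (m + 1)) *
      (1 - Ideal.Quotient.mk (Ideal.span {(X : ℤ⟦X⟧) ^ N}) X ^ (m + 1)) = 1 := by
  rw [← map_pow, ← map_one (Ideal.Quotient.mk _), ← map_sub, ← map_mul, geomSeries_mul]

theorem X_pow_dvd_expand_thetaPhiNeg_mul_mockB {N : ℕ} (hN : 0 < N) :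
    (X : ℤ⟦X⟧) ^ N ∣ expand 2 two_ne_zero thetaPhiNeg * mockB -
      ∑ k ∈ range N, lambertTerm X geomSeries k * X ^ (k * (k + 1)) := by
  have hX := mk_X_pow_eq_zero N
  have hB := mk_eq_mk_iff_X_pow_dvd.mpr (X_pow_dvd_mockB_sub N)
  have hphi : Ideal.Quotient.mk (Ideal.span {(X : ℤ⟦X⟧) ^ N}) (expand 2 two_ne_zero thetaPhiNeg) =
      Ideal.Quotient.mk (Ideal.span {(X : ℤ⟦X⟧) ^ N})
        (∑ k ∈ range N, (-1) ^ k * (X ^ (2 * k ^ 2) - X ^ (2 * (k + 1) ^ 2))) := by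
    rw [mk_eq_mk_iff_X_pow_dvd]
    have h := map_dvd (expand (R := ℤ) 2 two_ne_zero) (X_pow_dvd_thetaPhiNeg_sub N)
    simp only [map_sub, map_sum, map_mul, map_pow, map_neg, map_one, expand_X, ← pow_mul] at h
    exact (pow_dvd_pow _ (by omega)).trans h
  rw [← mk_eq_mk_iff_X_pow_dvd, map_mul, hphi, hB]
  simp only [mockTerm_eq_fineTerm, map_sum, map_mul, map_sub, map_pow, map_neg, map_one,
    ← map_lambertTerm, ← map_fineTerm]
  rw [sum_fineTerm_eq (mk_geomSeries_mul N) hX]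
  exact theta_mul_sum_fineNumerator (mk_geomSeries_mul N) hN
    (pow_eq_zero_of_le (by nlinarith) hX)

theorem X_pow_dvd_sum_lambertTerm_sub {N : ℕ} (hN : 0 < N) :
    (X : ℤ⟦X⟧) ^ N ∣ ∑ k ∈ range N, lambertTerm X geomSeries k - thetaPsi ^ 2 := by
  have hX := mk_X_pow_eq_zero N
  have hpsi := mk_eq_mk_iff_X_pow_dvd.mpr
    ((pow_dvd_pow _ (by omega)).trans (X_pow_dvd_thetaPsi_sub (2 * N)) :
      (X : ℤ⟦X⟧) ^ N ∣ _)
  rw [← mk_eq_mk_iff_X_pow_dvd, map_pow, hpsi]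
  simp only [map_sum, map_pow, ← map_lambertTerm]
  exact sum_lambertTerm_eq_sq (mk_geomSeries_mul N) hN hX

/-! ### Two successive dissections by parity of the exponent -/

/-- The series `∑ f_{2n} X^n`. -/
noncomputable def evenPart (f : ℤ⟦X⟧) : ℤ⟦X⟧ := PowerSeries.mk fun n => coeff (2 * n) f

/-- The series `∑ f_{2n+1} X^n`. -/
noncomputable def oddPart (f : ℤ⟦X⟧) : ℤ⟦X⟧ := PowerSeries.mk fun n => coeff (2 * n + 1) f

theorem coeff_even_expand_add (f g : ℤ⟦X⟧) (n : ℕ) :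
    coeff (2 * n) (expand 2 two_ne_zero f + X * expand 2 two_ne_zero g) = coeff n f := by
  rw [map_add, coeff_expand_mul]
  rcases n with _ | n
  · simp
  · rw [show 2 * (n + 1) = 2 * n + 1 + 1 by ring, coeff_succ_X_mul,
      coeff_expand_of_not_dvd _ _ _ (by omega), add_zero]

theorem coeff_odd_expand_add (f g : ℤ⟦X⟧) (n : ℕ) :
    coeff (2 * n + 1) (expand 2 two_ne_zero f + X * expand 2 two_ne_zero g) = coeff n g := by
  rw [map_add, coeff_succ_X_mul, coeff_expand_mul, coeff_expand_of_not_dvd _ _ _ (by omega),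
    zero_add]

theorem expand_evenPart_add (f : ℤ⟦X⟧) :
    expand 2 two_ne_zero (evenPart f) + X * expand 2 two_ne_zero (oddPart f) = f := by
  ext n
  obtain ⟨m, rfl | rfl⟩ := Nat.even_or_odd' n
  · rw [coeff_even_expand_add, evenPart, coeff_mk]
  · rw [coeff_odd_expand_add, oddPart, coeff_mk]

theorem expand_add_inj {f g f' g' : ℤ⟦X⟧}
    (h : expand 2 two_ne_zero f + X * expand 2 two_ne_zero g =
      expand 2 two_ne_zero f' + X * expand 2 two_ne_zero g') : f = f' ∧ g = g' := by
  constructor <;> ext n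
  · rw [← coeff_even_expand_add f g, h, coeff_even_expand_add]
  · rw [← coeff_odd_expand_add f g, h, coeff_odd_expand_add]

theorem expand_geomSeries (m : ℕ) :
    expand 2 two_ne_zero (geomSeries (m + 1)) = geomSeries (2 * (m + 1)) := by
  have h := congrArg (expand (R := ℤ) 2 two_ne_zero) (geomSeries_mul m)
  simp only [map_mul, map_sub, map_pow, map_one, expand_X, ← pow_mul] at h
  have h' := geomSeries_mul (2 * m + 1)
  rw [show 2 * m + 1 + 1 = 2 * (m + 1) by ring] at h'
  exact mul_right_cancel₀ (right_ne_zero_of_mul_eq_one h) (h.trans h'.symm)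

theorem geomSeries_eq (m : ℕ) :
    geomSeries (m + 1) = (1 + X ^ (m + 1)) * geomSeries (2 * (m + 1)) := by
  apply mul_right_cancel₀ (one_sub_X_pow_ne_zero m)
  have h := geomSeries_mul (2 * m + 1)
  rw [geomSeries_mul]
  linear_combination -h

/-- With x = X^{2k+1}, write (1 + x)/(1 - x) = (1 + x²)/(1 - x²) + 2x/(1 - x²). The even part of an
Appell-Lerch term is thus the Lambert term in X². -/
theorem lambertTerm_mul_X_pow (k : ℕ) :
    lambertTerm X geomSeries k * X ^ (k * (k + 1)) =
      expand 2 two_ne_zero (lambertTerm X geomSeries k) + X * expand 2 two_ne_zero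
        (2 * (-1) ^ k * X ^ (k * (k + 1) + k) * geomSeries (2 * k + 1)) := by
  simp only [lambertTerm, map_mul, map_add, map_pow, map_neg, map_one, map_ofNat, expand_X]
  rw [expand_geomSeries, geomSeries_eq (2 * k)]
  ring

theorem thetaPhiNeg_mul_evenPart_mockB : thetaPhiNeg * evenPart mockB = thetaPsi ^ 2 := by
  have key : ∀ N, 0 < N → (X : ℤ⟦X⟧) ^ N ∣ thetaPhiNeg * evenPart mockB - thetaPsi ^ 2 := by
    intro N hN
    have h1 := X_pow_dvd_expand_thetaPhiNeg_mul_mockB (show 0 < 2 * N by omega)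
    have h2 := X_pow_dvd_sum_lambertTerm_sub (show 0 < 2 * N by omega)
    rw [← expand_evenPart_add mockB, sum_congr rfl fun k _ => lambertTerm_mul_X_pow k,
      sum_add_distrib, ← mul_sum, ← map_sum, ← map_sum] at h1
    have h3 : (X : ℤ⟦X⟧) ^ N ∣ thetaPhiNeg * evenPart mockB -
        ∑ k ∈ range (2 * N), lambertTerm X geomSeries k := by
      rw [X_pow_dvd_iff] at h1 ⊢
      intro m hm
      rw [← h1 (2 * m) (by omega)]
      -- The second series is the odd component of the difference in `h1`, supplied to reassemble
      -- it; precision 2N is needed since coefficient m is read at 2m.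
      rw [← coeff_even_expand_add _ (thetaPhiNeg * oddPart mockB - ∑ k ∈ range (2 * N),
        2 * (-1) ^ k * X ^ (k * (k + 1) + k) * geomSeries (2 * k + 1))]
      congr 1
      simp only [map_sub, map_mul]
      ring
    have h4 := dvd_add h3 ((pow_dvd_pow _ (by omega)).trans h2)
    rwa [sub_add_sub_cancel] at h4
  rw [← sub_eq_zero]
  ext m
  exact X_pow_dvd_iff.mp (key (m + 1) m.succ_pos) m m.lt_succ_self

theorem thetaPhiNeg_eq :
    thetaPhiNeg = expand 2 two_ne_zero (evenPart thetaPhi) -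
      X * expand 2 two_ne_zero (oddPart thetaPhi) := by
  have h : evenPart thetaPhiNeg = evenPart thetaPhi := by
    ext n; simp [evenPart, thetaPhiNeg]
  have h' : oddPart thetaPhiNeg = -oddPart thetaPhi := by
    ext n; simp [oddPart, thetaPhiNeg, pow_succ]
  rw [← expand_evenPart_add thetaPhiNeg, h, h', map_neg]
  ring

/-- The generating function of `b(4n)` is congruent to `ψ(q)` modulo `8`. -/
theorem eight_dvd_evenPart_evenPart_sub :
    (8 : ℤ⟦X⟧) ∣ evenPart (evenPart mockB) - thetaPsi := by
  have h := thetaPhiNeg_mul_evenPart_mockB.trans thetaPsi_sq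
  obtain ⟨c, hc⟩ : ∃ c : ℤ⟦X⟧, oddPart thetaPhi = 2 * c := by
    choose c hc using even_coeff_thetaPhi
    refine ⟨PowerSeries.mk c, ?_⟩
    ext n
    rw [show (2 : ℤ⟦X⟧) = C (2 : ℤ) by simp, coeff_C_mul, oddPart, coeff_mk, coeff_mk, hc]
  rw [thetaPhiNeg_eq] at h
  set a := evenPart thetaPhi with ha
  have hphi := expand_evenPart_add thetaPhi
  have hB := expand_evenPart_add (evenPart mockB)
  rw [← ha, hc] at hphi
  rw [hc] at h
  set β₀ := evenPart (evenPart mockB)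
  set β₁ := oddPart (evenPart mockB)
  -- These are the even and odd parts of φ(-q) ∑ b(2n) q^n = ψ(q²) φ(q).
  obtain ⟨h0, h1⟩ : a * β₀ - X * (2 * c) * β₁ = thetaPsi * a ∧
      a * β₁ - 2 * c * β₀ = thetaPsi * (2 * c) := by
    apply expand_add_inj
    rw [← hphi, ← hB] at h
    simp only [map_sub, map_mul, expand_X] at h ⊢
    linear_combination h
  have hunit : IsUnit (a ^ 2 - X * (2 * c) ^ 2) := by
    rw [isUnit_iff_constantCoeff]
    have : constantCoeff a = 1 := by
      rw [← coeff_zero_eq_constantCoeff_apply, ha, evenPart, coeff_mk]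
      simpa using coeff_sq_thetaPhi 0
    simp [this]
  rw [← hunit.dvd_mul_left]
  -- Eliminating `β₁` gives (a² - 4Xc²)(β₀ - ψ) = 8Xc²ψ.
  exact ⟨X * c ^ 2 * thetaPsi, by linear_combination a * h0 + X * (2 * c) * h1⟩

theorem b_four_mul_modEq (n : ℕ) :
    b (4 * n) ≡ (if IsSquare (8 * n + 1) then 1 else 0) [ZMOD 8] := by
  obtain ⟨g, hg⟩ := eight_dvd_evenPart_evenPart_sub
  have h := congrArg (coeff n) hg
  rw [map_sub, evenPart, coeff_mk, evenPart, coeff_mk, coeff_thetaPsi,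
    show (8 : ℤ⟦X⟧) = C (8 : ℤ) by simp, coeff_C_mul, ← mul_assoc] at h
  exact (Int.modEq_iff_dvd.mpr ⟨_, h⟩).symm

end SecondOrderMock

/-! ### The congruences -/

theorem theorem1p1 (p : ℕ) [Fact p.Prime] (hp : p ≠ 2) :
    (∀ ℓ : ℕ, 1 ≤ ℓ → ℓ ≤ p - 1 → legendreSym p (8 * (ℓ : ℤ) + 1) = -1 →
      ∀ n : ℕ, SecondOrderMock.b (4 * (p * n + ℓ)) ≡ 0 [ZMOD 8]) ∧
    (∀ n k : ℕ, SecondOrderMock.b (4 * n) ≡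
      SecondOrderMock.b (4 * p ^ (2 * k + 2) * n + (p ^ (2 * k + 2) - 1) / 2) [ZMOD 8]) := by
  constructor
  · intro ℓ _ _ hℓ n
    refine (SecondOrderMock.b_four_mul_modEq _).trans ?_
    rw [if_neg]
    -- A square root of 8(pn + ℓ) + 1 would reduce mod p to one of the nonresidue 8ℓ + 1.
    rintro ⟨r, hr⟩
    rw [legendreSym.eq_neg_one_iff] at hℓ
    refine hℓ ⟨(r : ZMod p), ?_⟩
    have := congrArg (Nat.cast : ℕ → ZMod p) hr
    push_cast at this ⊢
    rw [← this, ZMod.natCast_self]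
    ring
  · intro n k
    obtain ⟨t, ht⟩ : ∃ t, p ^ (k + 1) = 2 * t + 1 :=
      ((Fact.out : p.Prime).odd_of_ne_two hp).pow
    obtain ⟨s, hs⟩ : ∃ s, t * (t + 1) = 2 * s :=
      ⟨_, (SecondOrderMock.two_mul_triangle t).symm⟩
    have hpow : p ^ (2 * k + 2) = 8 * s + 1 := by
      rw [show 2 * k + 2 = (k + 1) * 2 by ring, pow_mul, ht]
      linarith
    have harg : 4 * p ^ (2 * k + 2) * n + (p ^ (2 * k + 2) - 1) / 2 =
        4 * (p ^ (2 * k + 2) * n + s) := by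
      rw [hpow, show (8 * s + 1 - 1) / 2 = 4 * s by omega]
      ring
    -- The shift s = (p^{2k+2} - 1)/8 is chosen so that 8n + 1 is multiplied by a perfect square.
    have hsq : 8 * (p ^ (2 * k + 2) * n + s) + 1 = (p ^ (k + 1)) ^ 2 * (8 * n + 1) := by
      rw [← pow_mul, show (k + 1) * 2 = 2 * k + 2 by ring]
      linarith
    have hiff : IsSquare (8 * (p ^ (2 * k + 2) * n + s) + 1) ↔ IsSquare (8 * n + 1) := by
      rw [hsq]
      constructor
      · rintro ⟨r, hr⟩
        have hdvd : p ^ (k + 1) ∣ r :=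
          (Nat.pow_dvd_pow_iff two_ne_zero).mp ⟨8 * n + 1, by rw [hr, sq]⟩
        obtain ⟨m, rfl⟩ := hdvd
        refine ⟨m, Nat.eq_of_mul_eq_mul_left (pow_pos (pow_pos (Fact.out : p.Prime).pos (k + 1)) 2) ?_⟩
        rw [hr]
        ring
      · rintro ⟨m, hm⟩
        exact ⟨p ^ (k + 1) * m, by rw [hm]; ring⟩
    rw [harg]
    refine (SecondOrderMock.b_four_mul_modEq n).trans ?_
    simp only [← hiff]
    exact (SecondOrderMock.b_four_mul_modEq _).symm
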